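/- All complexes are over $\mathbb F_2$, with boundary maps of degree $-1$. Let $\mathcal E=\{\mathcal E(r)\}_{r\ge 0}$ be the Barratt–Eccles operad: $\mathcal E(r)=N_*(E(r))$ is the complex of normalized chains of the simplicial set $E(r)$ with $E(r)_n=\Sigma_r^{\,n+1}$ (faces delete an entry, degeneracies repeat one), with the left action of $\Sigma_r$ by multiplication in every entry, and its composition $\circ_{\mathcal E}$ is the iterated Eilenberg–Zilber shuffle map followed by the entrywise operadic composition $\circ_\Sigma$ of permutations. Let $A$ be an $\mathcal E$-algebra, that is, a chain complex with a morphism of operads $\mathcal E\to \mathrm{End}(A)=\{\mathrm{Hom}(A^{\otimes r},A)\}_{r\ge 0}$; write $x(a_1\otimes\cdots\otimes a_r)$ for the action of $x\in\mathcal E(r)$. For $i\ge 0$ put $\tilde x_i=(e,(12),e,\dots,(12)^i)\in\mathcal E(2)_i$ and $\alpha\smallsmile_i\beta=\tilde x_i(\alpha\otimes\beta)$. Let $f,g:\Sigma_2\to\Sigma_4$ be the homomorphisms $f(\sigma)=\circ_\Sigma(\sigma,e,e)$ and $g(\sigma)=\circ_\Sigma(e,\sigma,\sigma)$, so that $f(12)=(13)(24)$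 and $g(12)=(12)(34)$. For a simplex $(\sigma_0,\dots,\sigma_n)$ of $E(2)$ define in $\mathcal E(4)_{n+1}$ $$H_1(\sigma_0,\dots,\sigma_n)=\sum_{l=0}^n\big((23)f\sigma_0,\dots,(23)f\sigma_l,\,g\sigma_l,\dots,g\sigma_n\big),$$ $$H_2(\sigma_0,\dots,\sigma_n)=N_*(\circ_E)\big((e,\dots,e)\otimes SHI\big((\sigma_0,\dots,\sigma_n)\times(\sigma_0,\dots,\sigma_n)\big)\big),$$ where $\circ_E$ is $\circ_\Sigma$ in each entry and $SHI$ is the Shih homotopy: for $n$-simplices $x,y$ of simplicial sets, $$SHI(x\times y)=\sum s_{v_p+m}\cdots s_{v_1+m}s_{m-1}d_{n-p+1}\cdots d_n\,x\ \times\ s_{w_{q+1}+m}\cdots s_{w_1+m}d_{n-p-q}\cdots d_{n-p-1}\,y,$$ with $m=n-p-q$ and the sum over all $0\le p\le n-1$, $0\le q\le n-p-1$ and all pairs of disjoint subsets $\{v_1<\cdots<v_p\}$, $\{w_1<\cdots<w_{q+1}\}$ of $\{0,\dots,p+q\}$ (so $SHI=0$ for $n=0$). Theorem. Let $i\ge 0$,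 let $Z_i=(H_1+H_2)(\tilde x_i)\in\mathrm{Hom}(A^{\otimes 4},A)$ and $\zeta_i(\alpha\otimes\beta)=Z_i(\alpha\otimes\alpha\otimes\beta\otimes\beta)$. Then for all $\alpha,\beta\in A$ $$(\partial Z_i)(\alpha\otimes\alpha\otimes\beta\otimes\beta)=(\alpha\smallsmile_0\beta)\smallsmile_i(\alpha\smallsmile_0\beta)+\sum_{j+k=i}(\alpha\smallsmile_j\alpha)\smallsmile_0(\beta\smallsmile_k\beta),$$ where $\partial Z_i=\partial\circ Z_i+Z_i\circ\partial$. In particular $\zeta_i$ is a Cartan $i$-coboundary: for all cycles $\alpha,\beta$ of $A$ $$\partial\big(\zeta_i(\alpha\otimes\beta)\big)=(\alpha\smallsmile_0\beta)\smallsmile_i(\alpha\smallsmile_0\beta)+\sum_{j+k=i}(\alpha\smallsmile_j\alpha)\smallsmile_0(\beta\smallsmile_k\beta).$$ If $\alpha$ and $\beta$ are homogeneous of degrees $p$ and $q$, then $\zeta_i(\alpha\otimes\beta)$ is homogeneous of degree $2p+2q+i+1$, and $\zeta_i$ is natural for morphisms of $\mathcal E$-algebras. -/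

import Mathlib

universe u

namespace BarrattEccles

open CategoryTheory

noncomputable section

/-! ## Chain complexes over `𝔽₂` and their multilinear operations -/

/-- The total module `⨁ₙ Cₙ` of a chain complex of `𝔽₂`-vector spaces. -/
abbrev Tot (C : ChainComplex (ModuleCat.{u} (ZMod 2)) ℤ) : Type u :=
  DirectSum ℤ (fun n => C.X n)

/-- The homogeneous elements of degree `n`. -/
def deg (C : ChainComplex (ModuleCat.{u} (ZMod 2)) ℤ) (n : ℤ) : Submodule (ZMod 2) (Tot C) :=
  LinearMap.range (DirectSum.lof (ZMod 2) ℤ (fun n => C.X n) n)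

/-- The boundary map on the total module. -/
def dTot (C : ChainComplex (ModuleCat.{u} (ZMod 2)) ℤ) : Tot C →ₗ[ZMod 2] Tot C :=
  DirectSum.toModule (ZMod 2) ℤ (Tot C) fun n =>
    (DirectSum.lof (ZMod 2) ℤ (fun n => C.X n) (n - 1)).comp (C.d n (n - 1)).hom

/-- The linear map on total modules induced by a chain map. -/
def mapTot {C D : ChainComplex (ModuleCat.{u} (ZMod 2)) ℤ} (φ : C ⟶ D) :
    Tot C →ₗ[ZMod 2] Tot D :=
  DirectSum.toModule (ZMod 2) ℤ (Tot D) fun n =>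
    (DirectSum.lof (ZMod 2) ℤ (fun n => D.X n) n).comp (φ.f n).hom

/-- `r`-ary operations on `C`: linear maps `C^{⊗ r} → C`, presented as multilinear maps. -/
abbrev Op (C : ChainComplex (ModuleCat.{u} (ZMod 2)) ℤ) (r : ℕ) : Type u :=
  MultilinearMap (ZMod 2) (fun _ : Fin r => Tot C) (Tot C)

/-- The differential `∂φ = ∂ ∘ φ + φ ∘ ∂` of `Hom(C^{⊗ r}, C)`, evaluated at
`a₁ ⊗ ⋯ ⊗ aᵣ`; the boundary of `a₁ ⊗ ⋯ ⊗ aᵣ` is `∑ⱼ a₁ ⊗ ⋯ ⊗ ∂aⱼ ⊗ ⋯ ⊗ aᵣ`. -/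
def homDiff {C : ChainComplex (ModuleCat.{u} (ZMod 2)) ℤ} {r : ℕ} (φ : Op C r)
    (a : Fin r → Tot C) : Tot C :=
  dTot C (φ a) + ∑ j, φ (Function.update a j (dTot C (a j)))

/-! ## The simplicial sets `E(r)` and their normalized chains -/

/-- The `n`-simplices `(x 0, …, x n)` of the simplicial set with `Sⁿ⁺¹` as its set of
`n`-simplices. A monotone map `θ : {0, …, m} → {0, …, n}` acts by `x ↦ x ∘ θ`; so faces delete
an entry and degeneracies repeat one. -/
abbrev Simp (S : Type*) (n : ℕ) : Type _ := Fin (n + 1) → S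

/-- The `n`-simplices of `E(r)`. -/
abbrev E (r n : ℕ) : Type := Simp (Equiv.Perm (Fin r)) n

/-- `x` is in the image of a degeneracy, that is, two consecutive entries agree. -/
def IsDegenerate {S : Type*} {n : ℕ} (x : Simp S n) : Prop :=
  ∃ i : Fin n, x i.castSucc = x i.succ

/-- The span of the degenerate `n`-simplices of `E(r)`. -/
def degenerateChains (r n : ℕ) : Submodule (ZMod 2) (E r n →₀ ZMod 2) :=
  Submodule.span (ZMod 2) {c | ∃ x : E r n, IsDegenerate x ∧ c = Finsupp.single x 1}

/-- The degree `n` part of the Barratt–Eccles operad in arity `r`: the normalized `n`-chains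
of `E(r)` with coefficients in `𝔽₂`. -/
abbrev NE (r n : ℕ) : Type := (E r n →₀ ZMod 2) ⧸ degenerateChains r n

/-- The normalized chain represented by a simplex of `E(r)`. -/
def cls {r n : ℕ} (x : E r n) : NE r n :=
  Submodule.Quotient.mk (Finsupp.single x 1)

/-- The boundary `∑ᵢ dᵢ x` of a simplex of positive dimension. -/
def bdry {r n : ℕ} (x : E r (n + 1)) : NE r n :=
  ∑ i : Fin (n + 2), cls (fun t => x (i.succAbove t))

/-! ## The operadic composition -/

/-- Composition of permutations. Writing `τⱼ` as the word `τⱼ(1) ⋯ τⱼ(sⱼ)` in the `j`-th block of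
letters of `{1, …, s₁ + ⋯ + sᵣ}`, the result, as a word, is the concatenation of the words of
`τ_{σ(1)}, …, τ_{σ(r)}`. -/
def permComp {r : ℕ} {s : Fin r → ℕ} (σ : Equiv.Perm (Fin r))
    (τ : (j : Fin r) → Equiv.Perm (Fin (s j))) : Equiv.Perm (Fin (∑ j, s j)) :=
  (finCongr (Equiv.sum_comp σ s).symm).trans <|
    (finSigmaFinEquiv (n := fun i => s (σ i))).symm.trans <|
      (Equiv.sigmaCongrLeft (β := fun j => Fin (s j)) σ).trans <|
        (Equiv.sigmaCongrRight τ).trans finSigmaFinEquiv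

/-- The degrees of the `r + 1` factors `x ⊗ y₁ ⊗ ⋯ ⊗ yᵣ`; `none` stands for `x`. -/
def degs {r : ℕ} (n : ℕ) (m : Fin r → ℕ) (j : Option (Fin r)) : ℕ := j.elim n m

/-- The shuffles that index the iterated Eilenberg–Zilber map on a tensor product of simplices
of dimensions `n, m₁, …, mᵣ`: each of the steps `0, …, n + m₁ + ⋯ + mᵣ - 1` is allotted to one of
the factors, as many steps to a factor as its dimension. For two factors this is a
pair of disjoint complementary subsets of the set of steps. -/
def Shuffle {r : ℕ} (n : ℕ) (m : Fin r → ℕ) : Type :=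
  {c : Fin (n + ∑ j, m j) → Option (Fin r) //
    ∀ j, (Finset.univ.filter fun u => c u = j).card = degs n m j}

instance {r : ℕ} (n : ℕ) (m : Fin r → ℕ) : Fintype (Shuffle n m) :=
  inferInstanceAs (Fintype {c : Fin (n + ∑ j, m j) → Option (Fin r) //
    ∀ j, (Finset.univ.filter fun u => c u = j).card = degs n m j})

/-- The degeneracy operator that a shuffle applies to the factor `j`: the vertex `t` is sent to
the number of steps before `t` that are allotted to `j`. -/
def Shuffle.vertex {r n : ℕ} {m : Fin r → ℕ} (c : Shuffle n m) (j : Option (Fin r))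
    (t : Fin (n + ∑ j, m j + 1)) : Fin (degs n m j + 1) :=
  ⟨(Finset.univ.filter fun u : Fin (n + ∑ j, m j) => u.val < t.val ∧ c.1 u = j).card, by
    rw [← c.2 j]
    exact Nat.lt_succ_of_le (Finset.card_le_card fun u hu => by
      simp only [Finset.mem_filter] at hu ⊢
      exact ⟨hu.1, hu.2.2⟩)⟩

/-- The operadic composition of simplices `x ⊗ y₁ ⊗ ⋯ ⊗ yᵣ`: the iterated Eilenberg–Zilber map
followed by vertexwise composition of permutations. -/
def opComp {r n : ℕ} {s m : Fin r → ℕ} (x : E r n) (y : (j : Fin r) → E (s j) (m j)) :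
    NE (∑ j, s j) (n + ∑ j, m j) :=
  ∑ c : Shuffle n m, cls fun t =>
    permComp (x (c.vertex none t)) fun j => y j (c.vertex (some j) t)

/-! ## Algebras over the Barratt–Eccles operad -/

/-- An algebra structure over the Barratt–Eccles operad on a chain complex `C`: a morphism of
operads to the endomorphism operad of `C`. The conditions are stated on the simplices, whose
classes span the operad. -/
structure Algebra (C : ChainComplex (ModuleCat.{u} (ZMod 2)) ℤ) where
  /-- The operation given by an element of the operad of arity `r` and degree `n`. -/
  act : (r n : ℕ) → NE r n →ₗ[ZMod 2] Op C r
  /-- An element of degree `n` acts by an operation of degree `n`. -/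
  act_deg : ∀ (r n : ℕ) (x : NE r n) (a : Fin r → Tot C) (k : Fin r → ℤ),
    (∀ j, a j ∈ deg C (k j)) → act r n x a ∈ deg C (n + ∑ j, k j)
  /-- Compatibility with boundaries, in positive degree and in degree zero. -/
  act_bdry : ∀ (r n : ℕ) (x : E r (n + 1)) (a : Fin r → Tot C),
    homDiff (act r (n + 1) (cls x)) a = act r n (bdry x) a
  act_bdry_zero : ∀ (r : ℕ) (x : E r 0) (a : Fin r → Tot C),
    homDiff (act r 0 (cls x)) a = 0
  /-- Equivariance for the left actions of the symmetric groups; a permutation `σ` sends an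
  operation `φ` to `(a₁, …, aᵣ) ↦ φ (a_{σ(1)}, …, a_{σ(r)})`. -/
  act_perm : ∀ (r n : ℕ) (σ : Equiv.Perm (Fin r)) (x : E r n) (a : Fin r → Tot C),
    act r n (cls fun t => σ * x t) a = act r n (cls x) fun j => a (σ j)
  /-- The unit of the operad acts as the identity. -/
  act_unit : ∀ a : Fin 1 → Tot C, act 1 0 (cls fun _ => 1) a = a 0
  /-- Compatibility with composition. -/
  act_comp : ∀ (r n : ℕ) (s m : Fin r → ℕ) (x : E r n) (y : (j : Fin r) → E (s j) (m j))
    (a : Fin (∑ j, s j) → Tot C),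
    act (∑ j, s j) (n + ∑ j, m j) (opComp x y) a =
      act r n (cls x) fun j => act (s j) (m j) (cls (y j)) fun k => a (finSigmaFinEquiv ⟨j, k⟩)

/-- A chain map that commutes with the operations is a morphism of algebras. -/
def IsAlgebraHom {C D : ChainComplex (ModuleCat.{u} (ZMod 2)) ℤ} (A : Algebra C) (B : Algebra D)
    (φ : C ⟶ D) : Prop :=
  ∀ (r n : ℕ) (x : NE r n) (a : Fin r → Tot C),
    mapTot φ (A.act r n x a) = B.act r n x fun j => mapTot φ (a j)

/-! ## Cup-`i` products and Cartan coboundaries -/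

/-- The simplex `(e, (12), e, …, (12)ⁱ)` of `E(2)`. -/
def xTilde (i : ℕ) : E 2 i := fun t => (Equiv.swap 0 1) ^ (t : ℕ)

/-- The cup-`i` product. -/
def cup {C : ChainComplex (ModuleCat.{u} (ZMod 2)) ℤ} (A : Algebra C) (i : ℕ) (α β : Tot C) :
    Tot C :=
  A.act 2 i (cls (xTilde i)) ![α, β]

/-- The relation `(α ⌣₀ β) ⌣ᵢ (α ⌣₀ β) + ∑_{j + k = i} (α ⌣ⱼ α) ⌣₀ (β ⌣ₖ β)`. -/
def cartanRelation {C : ChainComplex (ModuleCat.{u} (ZMod 2)) ℤ} (A : Algebra C) (i : ℕ)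
    (α β : Tot C) : Tot C :=
  cup A i (cup A 0 α β) (cup A 0 α β) +
    ∑ jk ∈ Finset.HasAntidiagonal.antidiagonal i, cup A 0 (cup A jk.1 α α) (cup A jk.2 β β)

/-- `ζ` is a Cartan `i`-coboundary: on cycles `α, β` the boundary of `ζ(α ⊗ β)` is the
`i`-th Cartan relation. -/
def IsCartanCoboundary {C : ChainComplex (ModuleCat.{u} (ZMod 2)) ℤ} (A : Algebra C) (i : ℕ)
    (ζ : Tot C → Tot C → Tot C) : Prop :=
  ∀ α β : Tot C, dTot C α = 0 → dTot C β = 0 → dTot C (ζ α β) = cartanRelation A i α β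

/-! ## The homotopies `H₁` and `H₂` -/

/-- The identification of the permutations of `2 + 2` letters with those of `4` letters. -/
def perm4 : Equiv.Perm (Fin (∑ _ : Fin 2, 2)) ≃ Equiv.Perm (Fin 4) :=
  (finCongr (by simp)).permCongr

/-- `f σ = σ ∘ (e, e)`; so `f(12) = (13)(24)`. -/
def f (σ : Equiv.Perm (Fin 2)) : Equiv.Perm (Fin 4) :=
  perm4 (permComp (s := fun _ => 2) σ fun _ => 1)

/-- `g σ = e ∘ (σ, σ)`; so `g(12) = (12)(34)`. -/
def g (σ : Equiv.Perm (Fin 2)) : Equiv.Perm (Fin 4) :=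
  perm4 (permComp (s := fun _ => 2) 1 fun _ => σ)

/-- The transposition `(23)` of the letters `1, 2, 3, 4`, here numbered from `0`. -/
def swap23 : Equiv.Perm (Fin 4) := Equiv.swap 1 2

/-- `H₁ (x₀, …, xₙ) = ∑ᵢ ((23) f x₀, …, (23) f xᵢ, g xᵢ, …, g xₙ)`. -/
def H₁ {n : ℕ} (x : E 2 n) : NE 4 (n + 1) :=
  ∑ i : Fin (n + 1), cls fun t : Fin (n + 2) =>
    if t ≤ i.castSucc then swap23 * f (x (i.predAbove t)) else g (x (i.predAbove t))

/-- The vertex map of the iterated degeneracy `s_{vₖ} ⋯ s_{v₁}` for `V = {v₁ < ⋯ < vₖ}`. -/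
def degen (V : Finset ℕ) (t : ℕ) : ℕ := t - (V.filter (· < t)).card

/-- The vertex map of the iterated face `d_m ⋯ d_{m + q - 1}`, which skips `q` vertices. -/
def skip (m q t : ℕ) : ℕ := if t < m then t else t + q

/-- The entry of a simplex at a vertex number. Only vertex numbers `k ≤ n` occur below, and the
minimum serves to write `k` as an element of `Fin (n + 1)`. -/
def entry {S : Type*} {n : ℕ} (x : Simp S n) (k : ℕ) : S :=
  x ⟨min k n, Nat.lt_succ_of_le (Nat.min_le_right k n)⟩

/-- The pairs of disjoint subsets of `{0, …, a + b - 1}` with `a` and `b` elements. -/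
def disjointPairs (a b : ℕ) : Finset (Finset ℕ × Finset ℕ) :=
  ((Finset.powersetCard a (Finset.range (a + b))) ×ˢ
    (Finset.powersetCard b (Finset.range (a + b)))).filter fun VW => Disjoint VW.1 VW.2

/-- The summand of the Shih homotopy at `x × y` given by `p, q` and `(V, W)`: with `m = n - p - q`,
it is the simplex
`s_{v_p + m} ⋯ s_{v₁ + m} s_{m - 1} d_{n - p + 1} ⋯ d_n x ×
  s_{w_{q+1} + m} ⋯ s_{w₁ + m} d_{n - p - q} ⋯ d_{n - p - 1} y`.
The last faces `d_{n - p + 1} ⋯ d_n` do not change the numbers of the remaining vertices. -/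
def shihTerm {S T : Type*} {n : ℕ} (x : Simp S n) (y : Simp T n) (p q : ℕ)
    (VW : Finset ℕ × Finset ℕ) : Simp (S × T) (n + 1) := fun t =>
  let m := n - p - q
  (entry x (degen (insert (m - 1) (VW.1.image (· + m))) t),
    entry y (skip m q (degen (VW.2.image (· + m)) t)))

/-- `H₂ (x) = N(∘)((e, …, e) ⊗ SHI(x × x))`, where the Shih homotopy `SHI` is the sum of its
summands over `0 ≤ p ≤ n - 1`, `0 ≤ q ≤ n - p - 1` and all pairs of disjoint subsets of
`{0, …, p + q}` with `p` and `q + 1` elements. -/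
def H₂ {n : ℕ} (x : E 2 n) : NE 4 (n + 1) :=
  ∑ p ∈ Finset.range n, ∑ q ∈ Finset.range (n - p), ∑ VW ∈ disjointPairs p (q + 1),
    cls fun t => perm4 (permComp (s := fun _ => 2) 1
      ![(shihTerm x x p q VW t).1, (shihTerm x x p q VW t).2])

/-- The operation `(H₁ + H₂)(x̃ᵢ)` of arity four. -/
def cartanOp {C : ChainComplex (ModuleCat.{u} (ZMod 2)) ℤ} (A : Algebra C) (i : ℕ) : Op C 4 :=
  A.act 4 (i + 1) (H₁ (xTilde i) + H₂ (xTilde i))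

/-- `ζᵢ(α ⊗ β) = (H₁ + H₂)(x̃ᵢ)(α ⊗ α ⊗ β ⊗ β)`. -/
def zeta {C : ChainComplex (ModuleCat.{u} (ZMod 2)) ℤ} (A : Algebra C) (i : ℕ) (α β : Tot C) :
    Tot C :=
  cartanOp A i ![α, α, β, β]

end

end BarrattEccles

namespace BarrattEccles

/-! ### Homotopy identities for sums over lists of vertices -/

section ListChains

variable {M S T U V : Type*} [AddCommGroup M]

/-! Both `H₁` and `H₂` are chain homotopies. The prism `H₁` joins `(23) f` to `g`; the Shih homotopy
behind `H₂` joins the identity, which on the diagonal of `E(2)` yields `g` again, to the shuffle map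
after the Alexander–Whitney map. Hence `∂H + H∂` applied to `x̃ᵢ`, with `H = H₁ + H₂`, is `(23) f
x̃ᵢ` plus the Eilenberg–Zilber image of the diagonal of `x̃ᵢ`, since the two copies of `g x̃ᵢ`
cancel. Evaluated at `α ⊗ α ⊗ β ⊗ β`, the first is the cup-`i` square of `α ⌣₀ β`, and the second is
the sum over `j + k = i`.

It remains to see that `H(∂x̃ᵢ)` acts as zero there. Modulo degenerate simplices `∂x̃ᵢ = x̃ᵢ₋₁ +
(12) x̃ᵢ₋₁`, and `H` carries multiplication by `(12)` into multiplication by `g(12) = (12)(34)`,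
which fixes `α ⊗ α ⊗ β ⊗ β`. So the two terms agree, and they cancel over `𝔽₂`.

Chains are treated dually: a simplex is its list of vertices, and each operator is a sum of values
of an arbitrary function `φ` on lists. Prefixing a vertex to the argument of `φ` turns every
identity into an induction on lists. The homotopy identities are `prismSum_faceSum` and
`shihSum_faceSum`; `shihSum_ofFn` and `cup_zero_act` match the recursions with the explicit
formulas; `faceSum_orbitList` and the invariance of `evalList` dispose of `H(∂x̃ᵢ)`. -/

/-- The sum of `φ` over the faces of a simplex, given as the list of its vertices. -/
def faceSum (φ : List U → M) : List U → M
  | [] => 0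
  | x :: l => φ l + faceSum (fun l' => φ (x :: l')) l

/-- The sum of `φ` over the maximal lattice paths in a product of two simplices. -/
def shuffleSum (φ : List (S × T) → M) : List S → List T → M
  | [], _ => 0
  | _ :: _, [] => 0
  | [a], [b] => φ [(a, b)]
  | [a], b :: b' :: B => shuffleSum (fun l => φ ((a, b) :: l)) [a] (b' :: B)
  | a :: a' :: A, [b] => shuffleSum (fun l => φ ((a, b) :: l)) (a' :: A) [b]
  | a :: a' :: A, b :: b' :: B =>
    shuffleSum (fun l => φ ((a, b) :: l)) (a' :: A) (b :: b' :: B) +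
      shuffleSum (fun l => φ ((a, b) :: l)) (a :: a' :: A) (b' :: B)
  termination_by A B => A.length + B.length

/-- The sum of `ψ` over the pairs of a front face and a back face with one common vertex. -/
def splitSum (ψ : List S → List S → M) : List S → M
  | [] => 0
  | x :: l => ψ [x] (x :: l) + splitSum (fun A B => ψ (x :: A) B) l

/-- The sum of `φ` over the maximal simplices of the prism between the images under `F` and `G`. -/
def prismSum (F G : S → U) (φ : List U → M) : List S → M
  | [] => 0
  | x :: l => φ (F x :: G x :: l.map G) + prismSum F G (fun l' => φ (F x :: l')) l

/-- The sum of `φ` over the summands of the Shih homotopy at the diagonal of a simplex. -/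
def shihSum (φ : List (S × S) → M) : List S → M
  | [] => 0
  | x :: l => shihSum (fun l' => φ ((x, x) :: l')) l +
      splitSum (fun A B => shuffleSum (fun l' => φ ((x, x) :: l')) (x :: A) B) l

theorem shuffleSum_nil_left (φ : List (S × T) → M) (B : List T) : shuffleSum φ [] B = 0 := by
  rw [shuffleSum]

theorem shuffleSum_nil_right (φ : List (S × T) → M) (A : List S) : shuffleSum φ A [] = 0 := by
  cases A <;> rw [shuffleSum]

/-- The first step of a lattice path goes in one of two directions; when one is blocked, its summand
has an empty side and vanishes. Only the path without steps has to be excluded. -/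
theorem shuffleSum_cons_cons (φ : List (S × T) → M) (a : S) (A : List S) (b : T) (B : List T)
    (h : A ≠ [] ∨ B ≠ []) :
    shuffleSum φ (a :: A) (b :: B) =
      shuffleSum (fun l => φ ((a, b) :: l)) A (b :: B) +
        shuffleSum (fun l => φ ((a, b) :: l)) (a :: A) B := by
  rcases A with _ | ⟨a', A⟩ <;> rcases B with _ | ⟨b', B⟩
  · simp at h
  all_goals rw [shuffleSum]
  · rw [shuffleSum, zero_add]
  · rw [shuffleSum, add_zero]

theorem shuffleSum_singleton_left (φ : List (S × T) → M) (a : S) (B : List T) (hB : B ≠ []) :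
    shuffleSum φ [a] B = φ (B.map fun b => (a, b)) := by
  induction B generalizing φ with
  | nil => simp at hB
  | cons b B ih =>
    rcases B with _ | ⟨b', B⟩
    · rw [shuffleSum]; rfl
    · rw [shuffleSum, ih _ (by simp)]; rfl

theorem faceSum_add (φ ψ : List U → M) (l : List U) :
    faceSum (fun l => φ l + ψ l) l = faceSum φ l + faceSum ψ l := by
  induction l generalizing φ ψ with
  | nil => simp [faceSum]
  | cons x l ih => simp only [faceSum, ih]; abel

theorem faceSum_congr (φ ψ : List U → M) (l : List U)
    (h : ∀ l', l'.length + 1 = l.length → φ l' = ψ l') : faceSum φ l = faceSum ψ l := by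
  induction l generalizing φ ψ with
  | nil => rfl
  | cons x l ih =>
    rw [faceSum, faceSum, h l rfl]
    congr 1
    exact ih _ _ fun l' hl => h _ (by simp [hl])

theorem faceSum_map (e : S → U) (φ : List U → M) (l : List S) :
    faceSum φ (l.map e) = faceSum (fun l => φ (l.map e)) l := by
  induction l generalizing φ with
  | nil => rfl
  | cons x l ih => simp only [List.map_cons, faceSum, ih]

theorem shuffleSum_add (φ ψ : List (S × T) → M) (A : List S) (B : List T) :
    shuffleSum (fun l => φ l + ψ l) A B = shuffleSum φ A B + shuffleSum ψ A B := by
  fun_induction shuffleSum φ A B generalizing ψ <;> simp_all [shuffleSum]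
  abel

theorem splitSum_add (φ ψ : List S → List S → M) (l : List S) :
    splitSum (fun A B => φ A B + ψ A B) l = splitSum φ l + splitSum ψ l := by
  induction l generalizing φ ψ with
  | nil => simp [splitSum]
  | cons x l ih => simp only [splitSum, ih]; abel

theorem splitSum_congr (φ ψ : List S → List S → M) (l : List S)
    (h : ∀ A B, A.length + B.length = l.length + 1 → A ≠ [] → B ≠ [] → φ A B = ψ A B) :
    splitSum φ l = splitSum ψ l := by
  induction l generalizing φ ψ with
  | nil => rfl
  | cons x l ih =>
    rw [splitSum, splitSum, h [x] (x :: l) (by simp; omega) (by simp) (by simp)]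
    congr 1
    exact ih _ _ fun A B hl _ hB => h _ _ (by simp; omega) (by simp) hB

theorem prismSum_add (F G : S → U) (φ ψ : List U → M) (l : List S) :
    prismSum F G (fun l => φ l + ψ l) l = prismSum F G φ l + prismSum F G ψ l := by
  induction l generalizing φ ψ with
  | nil => simp [prismSum]
  | cons x l ih => simp only [prismSum, ih]; abel

theorem shihSum_add (φ ψ : List (S × S) → M) (l : List S) :
    shihSum (fun l => φ l + ψ l) l = shihSum φ l + shihSum ψ l := by
  induction l generalizing φ ψ with
  | nil => simp [shihSum]
  | cons x l ih => simp only [shihSum, ih, shuffleSum_add, splitSum_add]; abel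

variable [Module (ZMod 2) M]

/-- Consecutive simplices of the prism share an inner face, which cancels. The faces left over are
the two ends and those of the prisms over the faces of `l`. -/
theorem prismSum_faceSum (F G : S → U) (φ : List U → M) (l : List S) :
    prismSum F G (faceSum φ) l + faceSum (prismSum F G φ) l = φ (l.map F) + φ (l.map G) := by
  induction l generalizing φ with
  | nil => simp [prismSum, faceSum, ZModModule.add_self]
  | cons x l ih =>
    have h := ih fun l' => φ (F x :: l')
    simp only [prismSum, faceSum, prismSum_add, faceSum_add, List.map_cons, faceSum_map] at h ⊢
    have h2 := fun y : M => ZModModule.add_self y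
    calc _ = (prismSum F G (faceSum fun l' => φ (F x :: l')) l
          + faceSum (prismSum F G fun l' => φ (F x :: l')) l) + φ (G x :: l.map G)
          + φ (F x :: l.map G)
          + (faceSum (fun l => φ (F x :: G x :: l.map G)) l
            + faceSum (fun l => φ (F x :: G x :: l.map G)) l)
          + (prismSum F G φ l + prismSum F G φ l) := by abel
      _ = φ (F x :: l.map F) + φ (G x :: l.map G)
          + (φ (F x :: l.map G) + φ (F x :: l.map G)) := by
        rw [h, h2, h2]; abel
      _ = _ := by rw [h2, add_zero]

/-- Deleting a corner of a path gives a diagonal step, which arises from exactly two paths; every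
other face comes from a face of one factor. For a pair of points the left side is `φ []` and the
right side zero, hence the bound on lengths. -/
theorem shuffleSum_faceSum (φ : List (S × T) → M) (A : List S) (B : List T)
    (h : 2 < A.length + B.length) :
    shuffleSum (faceSum φ) A B =
      faceSum (fun A' => shuffleSum φ A' B) A + faceSum (fun B' => shuffleSum φ A B') B := by
  induction hn : A.length + B.length using Nat.strong_induction_on generalizing A B φ with
  | _ n ih =>
  subst hn
  rcases A with _ | ⟨a, A⟩
  · rw [shuffleSum_nil_left]
    rw [faceSum_congr _ (fun _ => 0) B fun l' _ => shuffleSum_nil_left _ _]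
    have : ∀ l : List T, faceSum (fun _ => (0 : M)) l = 0 := by
      intro l; induction l <;> simp_all [faceSum]
    simp [faceSum, this]
  rcases B with _ | ⟨b, B⟩
  · rw [shuffleSum_nil_right]
    rw [faceSum_congr _ (fun _ => 0) (a :: A) fun l' _ => shuffleSum_nil_right _ _]
    have : ∀ l : List S, faceSum (fun _ => (0 : M)) l = 0 := by
      intro l; induction l <;> simp_all [faceSum]
    simp [faceSum, this]
  have h2 := fun y : M => ZModModule.add_self y
  by_cases hA : A = []
  · subst hA
    have hB : B ≠ [] := by rintro rfl; simp at h
    rw [shuffleSum_singleton_left _ _ _ (by simp), faceSum_map]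
    simp only [faceSum, shuffleSum_nil_left, zero_add]
    rw [shuffleSum_singleton_left _ _ _ hB]
    congr 1
    exact faceSum_congr _ _ _ fun l' _ => by
      rw [shuffleSum_singleton_left _ _ _ (by simp)]
  by_cases hB : B = []
  · subst hB
    obtain ⟨a', A, rfl⟩ := List.exists_cons_of_ne_nil hA
    simp only [faceSum, shuffleSum, shuffleSum_add, shuffleSum_nil_right, add_zero]
    congr 1
    by_cases hA' : A = []
    · subst hA'
      simp [faceSum, shuffleSum]
    · rw [ih _ (by simp) _ _ _ (by have := List.length_pos_iff.2 hA'; simp; omega) rfl]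
      simp only [faceSum, shuffleSum_nil_right, add_zero]
      obtain ⟨a'', A, rfl⟩ := List.exists_cons_of_ne_nil hA'
      simp only [faceSum, shuffleSum]
  have lA := List.length_pos_iff.2 hA
  have lB := List.length_pos_iff.2 hB
  rw [shuffleSum_cons_cons _ _ _ _ _ (Or.inl hA)]
  simp only [faceSum, shuffleSum_add]
  rw [ih (A.length + (b :: B).length) (by simp) _ A (b :: B) (by simp; omega) rfl,
    ih ((a :: A).length + B.length) (by simp) _ (a :: A) B (by simp; omega) rfl]
  rw [faceSum_congr (fun l' => shuffleSum φ (a :: l') (b :: B)) _ A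
      fun l' _ => shuffleSum_cons_cons _ _ _ _ _ (Or.inr hB),
    faceSum_congr (fun l' => shuffleSum φ (a :: A) (b :: l')) _ B
      fun l' _ => shuffleSum_cons_cons _ _ _ _ _ (Or.inl hA)]
  simp only [faceSum, faceSum_add]
  rw [← sub_eq_zero]
  -- These are the paths with a diagonal first step: they occur twice, once for each way round the
  -- first square with its corner deleted.
  have h3 := h2 (shuffleSum (fun l => φ ((a, b) :: l)) A B)
  rw [← h3]
  abel

/-- Deleting the last vertex of a front face gives the same pair as splitting one vertex earlier and
deleting the first vertex of the back face. These terms cancel except at the two extremes. -/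
theorem splitSum_faceSum (ψ : List S → List S → M) (l : List S) :
    splitSum (fun A B => faceSum (fun A' => ψ A' B) A + faceSum (fun B' => ψ A B') B) l +
      faceSum (splitSum ψ) l = ψ [] l + ψ l [] := by
  have h2 := fun y : M => ZModModule.add_self y
  induction l generalizing ψ with
  | nil => simp [splitSum, faceSum, h2]
  | cons x l ih =>
    have h := ih fun A B => ψ (x :: A) B
    simp only [splitSum, faceSum, splitSum_add, faceSum_add] at h ⊢
    set X := splitSum (fun A B => faceSum (fun A' => ψ (x :: A') B) A) l
    set Y := splitSum (fun A B => faceSum (fun B' => ψ (x :: A) B') B) l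
    set Z := faceSum (splitSum fun A B => ψ (x :: A) B) l
    set P := faceSum (fun l' => ψ [x] (x :: l')) l
    set Q := splitSum (fun A B => ψ A B) l
    calc _ = (X + Y + Z) + (P + P) + (Q + Q) + ψ [] (x :: l) + ψ [x] l := by abel
      _ = (ψ [x] l + ψ [x] l) + ψ [] (x :: l) + ψ (x :: l) [] := by rw [h, h2, h2]; abel
      _ = _ := by rw [h2, zero_add]

/-- The composition of the Alexander–Whitney map and the shuffle map commutes with boundaries. -/
theorem splitSum_shuffleSum_faceSum (φ : List (S × S) → M) (l : List S) (h : 1 < l.length) :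
    splitSum (shuffleSum (faceSum φ)) l = faceSum (splitSum (shuffleSum φ)) l := by
  have h1 := splitSum_faceSum (shuffleSum φ) l
  rw [shuffleSum_nil_left, shuffleSum_nil_right, add_zero] at h1
  rw [splitSum_congr _ _ l fun A B hl _ _ => shuffleSum_faceSum φ A B (by omega)]
  exact sub_eq_zero.1 (by rw [ZModModule.sub_eq_add]; exact h1)

/-- The split at `x` itself is added and subtracted, so that the complete Eilenberg–Zilber composite
appears under the cone from `(x, x)`. The correction is a degenerate simplex, but it is kept because
`φ` need not vanish on such simplices. -/
theorem shihSum_cons (φ : List (S × S) → M) (x : S) (l : List S) :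
    shihSum φ (x :: l) = shihSum (fun l' => φ ((x, x) :: l')) l +
      splitSum (shuffleSum fun l' => φ ((x, x) :: l')) (x :: l) +
        φ ((x, x) :: (x :: l).map fun y => (x, y)) := by
  rw [shihSum, splitSum, shuffleSum_singleton_left _ _ _ (by simp)]
  have h2 := ZModModule.add_self (φ ((x, x) :: (x :: l).map fun y => (x, y)))
  rw [add_assoc, add_right_comm, h2, zero_add]

/-- The boundary of a cone is its base plus the cone on the boundary of the base. Applied to the
recursion `shihSum_cons`, this leaves the Eilenberg–Zilber composite and the cone on the diagonal of
`l`, because that composite commutes with faces. -/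
theorem shihSum_faceSum (φ : List (S × S) → M) (l : List S) (hl : l ≠ []) :
    shihSum (faceSum φ) l + faceSum (shihSum φ) l =
      splitSum (shuffleSum φ) l + φ (l.map fun x => (x, x)) := by
  have h2 := fun y : M => ZModModule.add_self y
  induction l generalizing φ with
  | nil => simp at hl
  | cons x l ih =>
    rcases eq_or_ne l [] with rfl | hl
    · simp [shihSum, faceSum, splitSum, shuffleSum, h2]
    have h := ih (fun l' => φ ((x, x) :: l')) hl
    have e := splitSum_shuffleSum_faceSum (fun l' => φ ((x, x) :: l')) (x :: l)
      (by have := List.length_pos_iff.2 hl; simp; omega)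
    have add' : ∀ ψ χ : List (S × S) → M, splitSum (shuffleSum fun l => ψ l + χ l) (x :: l) =
        splitSum (shuffleSum ψ) (x :: l) + splitSum (shuffleSum χ) (x :: l) := fun ψ χ => by
      rw [← splitSum_add]
      congr 1; funext A B; exact shuffleSum_add _ _ _ _
    simp only [shihSum_cons, faceSum, shihSum_add, add', faceSum_add, List.map_cons,
      faceSum_map] at h e ⊢
    rw [e]
    set X := shihSum (faceSum fun l' => φ ((x, x) :: l')) l
    set Y := faceSum (shihSum fun l' => φ ((x, x) :: l')) l
    set Z := shihSum φ l
    set P := splitSum (shuffleSum fun l' => φ ((x, x) :: l')) l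
    set Q := φ ((x, x) :: List.map (fun y => (x, y)) l)
    set R := faceSum (fun l' => splitSum (shuffleSum fun l' => φ ((x, x) :: l')) (x :: l')) l
    set W := faceSum (fun l' => φ ((x, x) :: (x, x) :: l'.map fun y => (x, y))) l
    set K := splitSum (shuffleSum φ) (x :: l)
    calc _ = (X + Y) + P + K + (Z + Z) + (R + R) + (Q + Q) + (W + W) := by abel
      _ = K + φ ((x, x) :: List.map (fun x => (x, x)) l) + (P + P) := by
        rw [h, h2 Z, h2 R, h2 Q, h2 W]; abel
      _ = _ := by rw [h2, add_zero]

end ListChains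

/-! ### Degenerate simplices, naturality in the vertices, and alternating simplices -/

section Normalized

variable {M S T U V : Type*} [AddCommGroup M]

/-- `φ` vanishes on degenerate simplices. -/
def Normalized (φ : List U → M) : Prop :=
  ∀ (l₁ : List U) (x : U) (l₂ : List U), φ (l₁ ++ x :: x :: l₂) = 0

theorem Normalized.cons {φ : List U → M} (h : Normalized φ) (x : U) :
    Normalized fun l => φ (x :: l) :=
  fun l₁ y l₂ => h (x :: l₁) y l₂

theorem Normalized.cons_cons {φ : List U → M} (h : Normalized φ) (x : U) (l : List U) :
    φ (x :: x :: l) = 0 :=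
  h [] x l

theorem Normalized.add {φ ψ : List U → M} (h : Normalized φ) (h' : Normalized ψ) :
    Normalized fun l => φ l + ψ l :=
  fun l₁ y l₂ => by simp [h l₁ y l₂, h' l₁ y l₂]

theorem Normalized.comp_map {φ : List U → M} (h : Normalized φ) (e : S → U) :
    Normalized fun l => φ (l.map e) :=
  fun l₁ y l₂ => by simpa using h (l₁.map e) (e y) (l₂.map e)

theorem prismSum_zero (F G : S → U) (l : List S) : prismSum F G (fun _ => (0 : M)) l = 0 := by
  induction l <;> simp_all [prismSum]

theorem splitSum_zero (l : List S) : splitSum (fun _ _ => (0 : M)) l = 0 := by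
  induction l <;> simp_all [splitSum]

theorem shuffleSum_zero (A : List S) (B : List T) :
    shuffleSum (fun _ => (0 : M)) A B = 0 := by
  simpa using shuffleSum_add (fun _ => (0 : M)) (fun _ => 0) A B

theorem shihSum_zero (l : List S) : shihSum (fun _ => (0 : M)) l = 0 := by
  simpa using shihSum_add (fun _ => (0 : M)) (fun _ => 0) l

theorem shuffleSum_swap (φ : List (S × T) → M) (A : List S) (B : List T) :
    shuffleSum (fun l => φ (l.map Prod.swap)) B A = shuffleSum φ A B := by
  fun_induction shuffleSum φ A B <;> simp_all [shuffleSum, shuffleSum_nil_right]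
  exact add_comm _ _

theorem shuffleSum_eq_zero_of_cons (φ : List (S × T) → M) (a : S) (A : List S) (b : T)
    (B : List T) (h : ∀ l, φ ((a, b) :: l) = 0) : shuffleSum φ (a :: A) (b :: B) = 0 := by
  by_cases hAB : A ≠ [] ∨ B ≠ []
  · rw [shuffleSum_cons_cons _ _ _ _ _ hAB]
    simp only [h, shuffleSum_zero, add_zero]
  · push Not at hAB
    obtain ⟨rfl, rfl⟩ := hAB
    rw [shuffleSum, h]

/-- A path that reaches the first copy of `x` either moves on to the second, repeating a vertex, or
advances in `B` with the repetition still ahead. This calls for an outer induction on `B`. -/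
theorem Normalized.shuffleSum_left {φ : List (S × T) → M} (h : Normalized φ) (B : List T) :
    Normalized fun A => shuffleSum φ A B := by
  intro l₁ x l₂
  show shuffleSum φ _ B = 0
  induction B generalizing φ l₁ with
  | nil => exact shuffleSum_nil_right _ _
  | cons b B ihB =>
    induction l₁ generalizing φ with
    | nil =>
      rw [List.nil_append, shuffleSum_cons_cons _ _ _ _ _ (Or.inl (by simp)),
        shuffleSum_eq_zero_of_cons _ _ _ _ _ fun l => h.cons_cons _ _, zero_add]
      exact ihB (h.cons _) []
    | cons y l₁ ih =>
      rw [List.cons_append, shuffleSum_cons_cons _ _ _ _ _ (Or.inl (by simp)), ih (h.cons _),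
        zero_add]
      exact ihB (h.cons _) (y :: l₁)

theorem Normalized.shuffleSum_right {φ : List (S × T) → M} (h : Normalized φ) (A : List S) :
    Normalized fun B => shuffleSum φ A B := by
  intro l₁ x l₂
  show shuffleSum φ A _ = 0
  rw [← shuffleSum_swap]
  exact (h.comp_map Prod.swap).shuffleSum_left A l₁ x l₂

/-- The front and back faces share a vertex, so two adjacent equal vertices always lie together in
one of them. -/
theorem Normalized.splitSum {ψ : List S → List S → M} (h : ∀ B, Normalized fun A => ψ A B)
    (h' : ∀ A, Normalized (ψ A)) : Normalized (splitSum ψ) := by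
  intro l₁ x l₂
  induction l₁ generalizing ψ with
  | nil =>
    have h1 : ψ [x] (x :: x :: l₂) = 0 := h' [x] [] x l₂
    have h2 : ∀ A B, ψ (x :: x :: A) B = 0 := fun A B => h B [] x A
    simp only [List.nil_append, BarrattEccles.splitSum, h1, h2, splitSum_zero, add_zero]
  | cons y l₁ ih =>
    have h1 : ψ [y] (y :: (l₁ ++ x :: x :: l₂)) = 0 := h' [y] (y :: l₁) x l₂
    rw [List.cons_append, BarrattEccles.splitSum, h1, zero_add]
    exact ih (fun B => (h B).cons y) fun A => h' (y :: A)

theorem Normalized.prismSum {φ : List U → M} (h : Normalized φ) (F G : S → U) :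
    Normalized (prismSum F G φ) := by
  intro l₁ x l₂
  induction l₁ generalizing φ with
  | nil =>
    have h1 : φ (F x :: G x :: G x :: l₂.map G) = 0 := h [F x] (G x) _
    simp only [List.nil_append, BarrattEccles.prismSum, List.map_cons, h1, h.cons_cons,
      prismSum_zero, add_zero]
  | cons y l₁ ih =>
    have h1 := h (F y :: G y :: l₁.map G) (G x) (l₂.map G)
    rw [List.cons_append, BarrattEccles.prismSum, ih (h.cons _), add_zero]
    simpa using h1

theorem Normalized.shihSum {φ : List (S × S) → M} (h : Normalized φ) :
    Normalized (shihSum φ) := by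
  intro l₁ x l₂
  induction l₁ generalizing φ with
  | nil =>
    have h1 : ∀ A B, shuffleSum (fun l' => φ ((x, x) :: l')) (x :: x :: A) B = 0 :=
      fun A B => (h.cons _).shuffleSum_left B [] x A
    simp only [List.nil_append, BarrattEccles.shihSum, BarrattEccles.splitSum, h1, h.cons_cons,
      shihSum_zero, shuffleSum_zero, splitSum_zero, add_zero]
  | cons y l₁ ih =>
    rw [List.cons_append, BarrattEccles.shihSum, ih (h.cons _), zero_add]
    exact Normalized.splitSum (fun B => ((h.cons _).shuffleSum_left B).cons y)
      (fun A => (h.cons _).shuffleSum_right (y :: A)) l₁ x l₂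

theorem shuffleSum_map (φ : List (U × V) → M) (u : S → U) (v : T → V) (A : List S)
    (B : List T) :
    shuffleSum φ (A.map u) (B.map v) =
      shuffleSum (fun l => φ (l.map (Prod.map u v))) A B := by
  symm
  generalize hψ : (fun l : List (S × T) => φ (l.map (Prod.map u v))) = ψ
  fun_induction shuffleSum ψ A B generalizing φ <;> subst hψ <;>
    simp_all [shuffleSum, shuffleSum_nil_right]
  case case4 ih => exact ih _ rfl
  case case5 ih => exact ih _ rfl
  case case6 ih1 ih2 => exact congrArg₂ (· + ·) (ih1 _ rfl) (ih2 _ rfl)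

theorem splitSum_map (ψ : List U → List U → M) (u : S → U) (l : List S) :
    splitSum ψ (l.map u) = splitSum (fun A B => ψ (A.map u) (B.map u)) l := by
  induction l generalizing ψ with
  | nil => rfl
  | cons x l ih => simp only [List.map_cons, splitSum, ih, List.map_nil]

theorem prismSum_map (F G : S → U) (φ : List U → M) (u : S → S) (w : U → U)
    (hF : ∀ s, F (u s) = w (F s)) (hG : ∀ s, G (u s) = w (G s)) (l : List S) :
    prismSum F G φ (l.map u) = prismSum F G (fun l => φ (l.map w)) l := by
  induction l generalizing φ with
  | nil => rfl
  | cons x l ih =>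
    simp only [List.map_cons, prismSum, ih, List.map_map, hF, hG]
    congr 4
    exact congrArg (List.map · l) (funext hG)

theorem shihSum_map (φ : List (U × U) → M) (u : S → U) (l : List S) :
    shihSum φ (l.map u) = shihSum (fun l => φ (l.map (Prod.map u u))) l := by
  induction l generalizing φ with
  | nil => rfl
  | cons x l ih =>
    simp only [List.map_cons, shihSum, ih, splitSum_map, Prod.map_apply]
    congr 2
    funext A B
    exact shuffleSum_map _ _ _ (x :: A) B

/-- The list `s, T s, T² s, …, Tⁿ s`. -/
def orbitList (T : S → S) (s : S) : ℕ → List S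
  | 0 => [s]
  | n + 1 => s :: orbitList T (T s) n

theorem orbitList_map (T : S → S) (s : S) (n : ℕ) :
    (orbitList T s n).map T = orbitList T (T s) n := by
  induction n generalizing s with
  | zero => rfl
  | succ n ih => simp only [orbitList, List.map_cons, ih]

/-- Since `T` is an involution, deleting an inner vertex brings two equal vertices together; only
the two outer faces survive. -/
theorem faceSum_orbitList {φ : List S → M} (h : Normalized φ) (T : S → S)
    (hT : ∀ s, T (T s) = s) (s : S) (n : ℕ) :
    faceSum φ (orbitList T s (n + 1)) = φ (orbitList T (T s) n) + φ (orbitList T s n) := by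
  induction n generalizing φ s with
  | zero => simp [orbitList, faceSum]
  | succ n ih =>
    rw [orbitList, faceSum, ih (h.cons s), hT]
    congr 1
    have h0 : φ (s :: orbitList T s n) = 0 := by cases n <;> exact h.cons_cons _ _
    rw [h0, zero_add]
    rfl

theorem splitSum_orbitList (ψ : List S → List S → M) (T : S → S) (s : S) (n : ℕ) :
    splitSum ψ (orbitList T s n) = ∑ jk ∈ Finset.HasAntidiagonal.antidiagonal n,
      ψ (orbitList T s jk.1) (orbitList T (T^[jk.1] s) jk.2) := by
  induction n generalizing ψ s with
  | zero => simp [orbitList, splitSum]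
  | succ n ih =>
    rw [orbitList, splitSum, ih, Finset.Nat.antidiagonal_succ, Finset.sum_cons, Finset.sum_map]
    rfl

end Normalized

/-! ### Lattice paths as sets of steps, and the explicit Shih formula -/

open Finset in
theorem sum_powersetCard_succ_range_succ {M : Type*} [AddCommMonoid M] (F : Finset ℕ → M)
    (k N : ℕ) :
    ∑ V ∈ powersetCard (k + 1) (range (N + 1)), F V =
      ∑ V ∈ powersetCard (k + 1) (range N), F (V.map (addRightEmbedding 1)) +
        ∑ V ∈ powersetCard k (range N), F (insert 0 (V.map (addRightEmbedding 1))) := by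
  have h0 : ∀ V : Finset ℕ, 0 ∉ V.map (addRightEmbedding 1) := fun V => by simp
  have hr : range (N + 1) = insert 0 ((range N).map (addRightEmbedding 1)) := range_add_one' N
  have hd : Disjoint (powersetCard (k + 1) ((range N).map (addRightEmbedding 1)))
      ((powersetCard k ((range N).map (addRightEmbedding 1))).image (insert 0)) := by
    rw [Finset.disjoint_left]
    intro V hV hV'
    obtain ⟨W, _, rfl⟩ := Finset.mem_image.1 hV'
    exact h0 _ ((mem_powersetCard.1 hV).1 (mem_insert_self _ _))
  rw [hr, powersetCard_succ_insert (h0 _), sum_union hd, sum_image]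
  · simp only [powersetCard_map, sum_map]
    rfl
  · intro V hV W hW h
    have hV' : 0 ∉ V := fun h => h0 _ ((mem_powersetCard.1 hV).1 h)
    have hW' : 0 ∉ W := fun h => h0 _ ((mem_powersetCard.1 hW).1 h)
    rw [← erase_insert hV', ← erase_insert hW', h]

/-- The number of elements of `V` below `t`. -/
def countBelow (V : Finset ℕ) (t : ℕ) : ℕ := (V.filter (· < t)).card

theorem countBelow_le (V : Finset ℕ) (t : ℕ) : countBelow V t ≤ t := by
  refine (Finset.card_le_card (t := Finset.range t) ?_).trans (Finset.card_range t).le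
  exact fun x hx => by simpa using (Finset.mem_filter.1 hx).2

theorem countBelow_zero (V : Finset ℕ) : countBelow V 0 = 0 :=
  Nat.le_zero.1 (countBelow_le V 0)

theorem countBelow_map (V : Finset ℕ) (t m : ℕ) :
    countBelow (V.map (addRightEmbedding m)) (t + m) = countBelow V t := by
  simp [countBelow, Finset.filter_map]

theorem countBelow_insert (V : Finset ℕ) (a t : ℕ) (ha : a ∉ V) (h : a < t) :
    countBelow (insert a V) t = countBelow V t + 1 := by
  rw [countBelow, Finset.filter_insert, if_pos h, Finset.card_insert_of_notMem (by simp [ha])]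
  rfl

theorem countBelow_eq_zero (V : Finset ℕ) (t : ℕ) (h : ∀ v ∈ V, t ≤ v) : countBelow V t = 0 := by
  rw [countBelow, Finset.card_eq_zero, Finset.filter_eq_empty_iff]
  exact fun v hv => not_lt.2 (h v hv)

theorem countBelow_range (n t : ℕ) (h : t ≤ n) : countBelow (Finset.range n) t = t := by
  have : (Finset.range n).filter (· < t) = Finset.range t := by ext; simp; omega
  rw [countBelow, this, Finset.card_range]

theorem countBelow_sdiff (V : Finset ℕ) (n t : ℕ) (h : t ≤ n) :
    countBelow (Finset.range n \ V) t = t - countBelow V t := by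
  have e : (Finset.range n \ V).filter (· < t) = Finset.range t \ V.filter (· < t) := by
    ext x; simp; grind
  rw [countBelow, e, Finset.card_sdiff_of_subset (fun x hx => by simp at hx ⊢; exact hx.2),
    Finset.card_range]
  rfl

theorem range_map_succ {S : Type*} (α : ℕ → S) (n : ℕ) :
    (List.range (n + 1)).map α = α 0 :: (List.range n).map fun t => α (t + 1) := by
  rw [List.range_succ_eq_map, List.map_cons, List.map_map]
  rfl

section

variable {M S T U : Type*} [AddCommGroup M]

theorem shuffleSum_singleton_right (φ : List (S × T) → M) (A : List S) (b : T) (hA : A ≠ []) :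
    shuffleSum φ A [b] = φ (A.map fun a => (a, b)) := by
  rw [← shuffleSum_swap, shuffleSum_singleton_left _ _ _ hA, List.map_map]
  rfl

/-- The lattice paths are indexed by the sets of their steps in the second direction. -/
theorem shuffleSum_eq_sum (φ : List (S × T) → M) (α : ℕ → S) (β : ℕ → T) (p q N : ℕ)
    (hN : N = p + q) :
    shuffleSum φ ((List.range (p + 1)).map α) ((List.range (q + 1)).map β) =
      ∑ V ∈ Finset.powersetCard q (Finset.range N),
        φ ((List.range (N + 1)).map fun t => (α (t - countBelow V t), β (countBelow V t))) := by
  induction N generalizing p q α β φ with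
  | zero =>
    obtain ⟨rfl, rfl⟩ : p = 0 ∧ q = 0 := by omega
    simp [shuffleSum, countBelow]
  | succ N ih =>
    rcases p with _ | p
    · obtain rfl : q = N + 1 := by omega
      have e : Finset.powersetCard (N + 1) (Finset.range (N + 1)) = {Finset.range (N + 1)} := by
        simpa using Finset.powersetCard_self (Finset.range (N + 1))
      rw [e, Finset.sum_singleton]
      simp only [zero_add, List.range_one, List.map_cons, List.map_nil]
      rw [shuffleSum_singleton_left _ _ _ (by simp), List.map_map]
      congr 1
      refine List.map_congr_left fun t ht => ?_
      rw [countBelow_range _ _ (by simp at ht; omega)]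
      simp
    rcases q with _ | q
    · obtain rfl : p = N := by omega
      simp only [zero_add, List.range_one, List.map_cons, List.map_nil]
      rw [shuffleSum_singleton_right _ _ _ (by simp), List.map_map]
      simp [countBelow, Function.comp_def]
    -- The first step of the path is in the second direction exactly when `0 ∈ V`, so both sides
    -- split in the same way.
    rw [range_map_succ α, range_map_succ β, shuffleSum_cons_cons _ _ _ _ _ (Or.inl (by simp)),
      ← range_map_succ α, ← range_map_succ β, ih _ _ _ p (q + 1) (by omega),
      ih _ _ _ (p + 1) q (by omega), sum_powersetCard_succ_range_succ]
    congr 1 <;> refine Finset.sum_congr rfl fun V _ => ?_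
    · rw [range_map_succ _ (N + 1)]
      simp only [countBelow_zero, countBelow_map]
      congr 2
      refine List.map_congr_left fun t _ => ?_
      rw [Nat.sub_add_comm (countBelow_le V t)]
    · rw [range_map_succ _ (N + 1)]
      simp only [countBelow_zero]
      congr 2
      refine List.map_congr_left fun t _ => ?_
      rw [countBelow_insert _ 0 (t + 1) (by simp) (by simp), countBelow_map,
        Nat.add_sub_add_right]

theorem splitSum_eq_sum (ψ : List S → List S → M) (ξ : ℕ → S) (n : ℕ) :
    splitSum ψ ((List.range (n + 1)).map ξ) = ∑ p ∈ Finset.range (n + 1),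
      ψ ((List.range (n - p + 1)).map ξ)
        ((List.range (p + 1)).map fun t => ξ (n - p + t)) := by
  induction n generalizing ψ ξ with
  | zero => simp [splitSum]
  | succ n ih =>
    rw [range_map_succ, splitSum, ih, Finset.sum_range_succ _ (n + 1), add_comm]
    congr 1
    · refine Finset.sum_congr rfl fun p hp => ?_
      have hp := Finset.mem_range.1 hp
      rw [show n + 1 - p = n - p + 1 by omega, range_map_succ ξ]
      congr 1
      exact List.map_congr_left fun t _ => by congr 1; omega
    · rw [← range_map_succ]
      simp

/-- The summands of the Shih homotopy are cones of lattice paths. -/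
theorem shihSum_eq_sum_shuffleSum (φ : List (S × S) → M) (ξ : ℕ → S) (n : ℕ) :
    shihSum φ ((List.range (n + 1)).map ξ) =
      ∑ p ∈ Finset.range n, ∑ q ∈ Finset.range (n - p),
        shuffleSum (fun l => φ ((List.range (n - p - q)).map (fun t => (ξ t, ξ t)) ++ l))
          ((List.range (q + 1 + 1)).map fun t => ξ (n - p - q - 1 + t))
          ((List.range (p + 1)).map fun t => ξ (n - p - q + q + t)) := by
  induction n generalizing φ ξ with
  | zero => simp [shihSum, splitSum]
  | succ n ih =>
    rw [range_map_succ, shihSum, ih, splitSum_eq_sum]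
    -- The last index `q = n - p` gives the new paths, prefixed by the vertex `0` alone; smaller `q`
    -- give the terms for the tail, prefixed by one more vertex.
    have h : ∀ p ∈ Finset.range (n + 1), ∑ q ∈ Finset.range (n + 1 - p),
        shuffleSum (fun l => φ ((List.range (n + 1 - p - q)).map (fun t => (ξ t, ξ t)) ++ l))
          ((List.range (q + 1 + 1)).map fun t => ξ (n + 1 - p - q - 1 + t))
          ((List.range (p + 1)).map fun t => ξ (n + 1 - p - q + q + t)) =
        ∑ q ∈ Finset.range (n - p),
          shuffleSum (fun l => φ ((ξ 0, ξ 0) ::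
              ((List.range (n - p - q)).map (fun t => (ξ (t + 1), ξ (t + 1))) ++ l)))
            ((List.range (q + 1 + 1)).map fun t => ξ (n - p - q - 1 + t + 1))
            ((List.range (p + 1)).map fun t => ξ (n - p - q + q + t + 1)) +
        shuffleSum (fun l' => φ ((ξ 0, ξ 0) :: l'))
          (ξ 0 :: (List.range (n - p + 1)).map fun t => ξ (t + 1))
          ((List.range (p + 1)).map fun t => ξ (n - p + t + 1)) := by
      intro p hp
      have hp := Finset.mem_range.1 hp
      rw [show n + 1 - p = n - p + 1 by omega, Finset.sum_range_succ]
      congr 1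
      · refine Finset.sum_congr rfl fun q hq => ?_
        have hq := Finset.mem_range.1 hq
        rw [show n - p + 1 - q = n - p - q + 1 by omega, range_map_succ (fun t => (ξ t, ξ t))]
        congr 1 <;> refine List.map_congr_left fun t _ => ?_ <;> congr 1 <;> omega
      · rw [show n - p + 1 - (n - p) = 1 by omega, ← range_map_succ ξ]
        congr 1 <;> refine List.map_congr_left fun t _ => ?_ <;> congr 1 <;> omega
    rw [Finset.sum_congr rfl h, Finset.sum_add_distrib]
    congr 1
    rw [Finset.sum_range_succ, Nat.sub_self, Finset.range_zero, Finset.sum_empty, add_zero]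

-- Disjoint subsets whose sizes add up to `a + b` are complementary in `{0, …, a + b - 1}`, so the
-- first determines the second.
open Finset in
theorem sum_disjointPairs (G : Finset ℕ × Finset ℕ → M) (a b : ℕ) :
    ∑ VW ∈ disjointPairs a b, G VW =
      ∑ V ∈ powersetCard a (range (a + b)), G (V, range (a + b) \ V) := by
  refine sum_bij' (fun VW _ => VW.1) (fun V _ => (V, range (a + b) \ V)) ?_ ?_ ?_ ?_ ?_
  · intro VW h
    simp only [disjointPairs, mem_filter, mem_product] at h
    exact h.1.1
  · intro V h
    have h' := mem_powersetCard.1 h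
    simp only [disjointPairs, mem_filter, mem_product]
    refine ⟨⟨h, mem_powersetCard.2 ⟨sdiff_subset, ?_⟩⟩, disjoint_sdiff⟩
    rw [card_sdiff_of_subset h'.1, h'.2, card_range]
    omega
  · intro VW h
    simp only [disjointPairs, mem_filter, mem_product, mem_powersetCard] at h
    refine Prod.ext rfl (eq_of_subset_of_card_le ?_ ?_).symm
    · exact subset_sdiff.2 ⟨h.1.2.1, h.2.symm⟩
    · rw [card_sdiff_of_subset h.1.1.1, h.1.1.2, card_range, h.1.2.2]
      omega
  · intro V _; rfl
  · intro VW h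
    simp only [disjointPairs, mem_filter, mem_product, mem_powersetCard] at h
    congr 1
    refine Prod.ext rfl (eq_of_subset_of_card_le ?_ ?_)
    · exact subset_sdiff.2 ⟨h.1.2.1, h.2.symm⟩
    · rw [card_sdiff_of_subset h.1.1.1, h.1.1.2, card_range, h.1.2.2]
      omega

end

/-! ### Sums over lists and sums over simplices -/

section

variable {M S T U : Type*} [AddCommGroup M]

theorem ofFn_eq_range_map_entry {n : ℕ} (x : Simp S n) :
    List.ofFn x = (List.range (n + 1)).map (entry x) := by
  refine List.ext_getElem (by simp) fun t h _ => ?_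
  simp only [List.length_ofFn] at h
  simp only [List.getElem_ofFn, List.getElem_map, List.getElem_range, entry]
  congr 2
  omega

/-- The number of a vertex after the degeneracies in the first factor of the Shih homotopy. -/
theorem degen_insert_map (V : Finset ℕ) (m k : ℕ) (hm : 0 < m) :
    degen (insert (m - 1) (V.image (· + m))) (m + k) = m - 1 + (k - countBelow V k) := by
  have h := countBelow_insert (V.map (addRightEmbedding m)) (m - 1) (k + m)
    (by simp; intro x _; omega) (by omega)
  have e : V.map (addRightEmbedding m) = V.image (· + m) := Finset.map_eq_image _ _
  rw [countBelow_map, e] at h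
  have := countBelow_le V k
  rw [degen, add_comm m k]
  change k + m - countBelow _ _ = _
  omega

theorem degen_map (V : Finset ℕ) (m k : ℕ) :
    degen (V.image (· + m)) (m + k) = m + (k - countBelow V k) := by
  have e : V.map (addRightEmbedding m) = V.image (· + m) := Finset.map_eq_image _ _
  have := countBelow_le V k
  rw [degen, add_comm m k, ← e]
  change k + m - countBelow _ _ = _
  rw [countBelow_map]
  omega

theorem degen_eq_self (V : Finset ℕ) (t : ℕ) (h : ∀ v ∈ V, t ≤ v) : degen V t = t := by
  change t - countBelow V t = t
  rw [countBelow_eq_zero V t h, Nat.sub_zero]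

/-- Below `m = n - p - q` the degeneracies do nothing. From there on, `s_{m-1}` makes the first
coordinate restart at `m - 1`, the faces make the second jump to `m + q`, and `V` lists the steps of
the path in the second direction. -/
theorem ofFn_shihTerm {n : ℕ} (x : Simp S n) (y : Simp T n) (p q : ℕ) (h : p + q < n)
    (V : Finset ℕ) :
    List.ofFn (shihTerm x y p q (V, Finset.range (p + (q + 1)) \ V)) =
      (List.range (n - p - q)).map (fun t => (entry x t, entry y t)) ++
        (List.range (q + 1 + p + 1)).map fun t =>
          (entry x (n - p - q - 1 + (t - countBelow V t)),
            entry y (n - p - q + q + countBelow V t)) := by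
  obtain ⟨m, rfl⟩ : ∃ m, n = m + p + q := ⟨n - p - q, by omega⟩
  have hm : 0 < m := by omega
  have e : m + p + q - p - q = m := by omega
  have e2 : m + p + q + 1 + 1 = m + (q + 1 + p + 1) := by omega
  have e3 : List.ofFn (shihTerm x y p q (V, Finset.range (p + (q + 1)) \ V)) =
      (List.range (m + p + q + 1 + 1)).map fun t =>
        (entry x (degen (insert (m - 1) (V.image (· + m))) t),
          entry y (skip m q (degen ((Finset.range (p + (q + 1)) \ V).image (· + m)) t))) := by
    refine List.ext_getElem (by simp) fun t h _ => ?_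
    simp only [List.getElem_ofFn, List.getElem_map, List.getElem_range, shihTerm, e]
  rw [e3, e, e2, List.range_add, List.map_append, List.map_map]
  congr 1 <;> refine List.map_congr_left fun t ht => ?_ <;> have ht := List.mem_range.1 ht
  · have ht' : t < m := by omega
    rw [degen_eq_self _ t fun v hv => by grind, degen_eq_self _ t fun v hv => by grind, skip,
      if_pos ht']
  · rw [Function.comp_apply, degen_insert_map _ _ _ hm, degen_map,
      countBelow_sdiff _ _ _ (by omega), Nat.sub_sub_self (countBelow_le V t), skip,
      if_neg (by omega), Nat.add_right_comm m (countBelow V t) q]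

theorem shihSum_ofFn (φ : List (S × S) → M) {n : ℕ} (x : Simp S n) :
    shihSum φ (List.ofFn x) =
      ∑ p ∈ Finset.range n, ∑ q ∈ Finset.range (n - p), ∑ VW ∈ disjointPairs p (q + 1),
        φ (List.ofFn (shihTerm x x p q VW)) := by
  rw [ofFn_eq_range_map_entry, shihSum_eq_sum_shuffleSum]
  refine Finset.sum_congr rfl fun p hp => Finset.sum_congr rfl fun q hq => ?_
  have hp := Finset.mem_range.1 hp
  have hq := Finset.mem_range.1 hq
  rw [sum_disjointPairs, shuffleSum_eq_sum _ (fun t => entry x (n - p - q - 1 + t))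
    (fun t => entry x (n - p - q + q + t)) (q + 1) p (p + (q + 1)) (by omega)]
  refine Finset.sum_congr rfl fun V _ => ?_
  rw [ofFn_shihTerm x x p q (by omega), show q + 1 + p + 1 = p + (q + 1) + 1 by omega]

theorem prismSum_ofFn (F G : S → U) (φ : List U → M) (n : ℕ) (x : Fin n → S) :
    prismSum F G φ (List.ofFn x) = ∑ i : Fin n, φ (List.ofFn fun t : Fin (n + 1) =>
      if t ≤ i.castSucc then F (x (i.predAbove t)) else G (x (i.predAbove t))) := by
  induction n generalizing φ with
  | zero => simp [prismSum]
  | succ n ih =>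
    rw [List.ofFn_succ, prismSum, ih, Fin.sum_univ_succ]
    congr 1
    · congr 1
      simp [List.ofFn_succ, List.map_ofFn, Function.comp_def]
    · refine Finset.sum_congr rfl fun i _ => ?_
      congr 1
      rw [List.ofFn_succ]
      simp [Fin.succ_predAbove_succ]

theorem faceSum_ofFn (φ : List U → M) (n : ℕ) (x : Fin (n + 1) → U) :
    faceSum φ (List.ofFn x) =
      ∑ i : Fin (n + 1), φ (List.ofFn fun t : Fin n => x (i.succAbove t)) := by
  induction n generalizing φ with
  | zero => simp [faceSum]
  | succ n ih =>
    rw [List.ofFn_succ, faceSum, ih, Fin.sum_univ_succ (n := n + 1)]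
    refine congrArg₂ (· + ·) rfl (Finset.sum_congr rfl fun i _ => ?_)
    rw [List.ofFn_succ (f := fun t => x (i.succ.succAbove t))]
    simp

end

/-! ### Evaluating the operations of an algebra -/

section Evaluation

open CategoryTheory

variable {C : ChainComplex (ModuleCat.{u} (ZMod 2)) ℤ} (A : Algebra C)

/-- The value at `a` of the operation given by a simplex, as a function of the list of vertices. -/
noncomputable def evalList {r : ℕ} (a : Fin r → Tot C) (l : List (Equiv.Perm (Fin r))) : Tot C :=
  -- The default entry is read only when the list is empty.
  A.act r (l.length - 1) (cls fun t => l.getD t 1) a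

theorem act_cls_eq_evalList {r n : ℕ} (a : Fin r → Tot C) (x : E r n) :
    A.act r n (cls x) a = evalList A a (List.ofFn x) := by
  -- The dimension read off from a list equals `n` only propositionally, so it is made a variable
  -- that can be substituted.
  have key : ∀ (k : ℕ) (l : List (Equiv.Perm (Fin r))), k = n →
      (∀ t : Fin (n + 1), l.getD t 1 = x t) →
      A.act r n (cls x) a = A.act r k (cls fun t => l.getD t 1) a := by
    rintro k l rfl h
    congr 3
    exact funext fun t => (h t).symm
  exact key _ _ (by simp) fun t => by
    rw [List.getD_eq_getElem _ _ (by simp [t.is_le]), List.getElem_ofFn]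

theorem cls_eq_zero {r n : ℕ} (x : E r n) (h : IsDegenerate x) : cls x = 0 :=
  (Submodule.Quotient.mk_eq_zero _).2 (Submodule.subset_span ⟨x, h, rfl⟩)

theorem normalized_evalList {r : ℕ} (a : Fin r → Tot C) : Normalized (evalList A a) := by
  intro l₁ x l₂
  rw [evalList, cls_eq_zero, map_zero, zero_apply]
  refine ⟨⟨l₁.length, by simp⟩, ?_⟩
  simp [List.getD_eq_getElem?_getD]

theorem homDiff_act_cls {r n : ℕ} (a : Fin r → Tot C) (x : E r (n + 1)) :
    homDiff (A.act r (n + 1) (cls x)) a = faceSum (evalList A a) (List.ofFn x) := by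
  rw [A.act_bdry, bdry, map_sum, sum_apply, faceSum_ofFn]
  exact Finset.sum_congr rfl fun i _ => act_cls_eq_evalList A a _

theorem homDiff_add {r : ℕ} (φ ψ : Op C r) (a : Fin r → Tot C) :
    homDiff (φ + ψ) a = homDiff φ a + homDiff ψ a := by
  simp only [homDiff, add_apply, map_add, Finset.sum_add_distrib]
  abel

theorem homDiff_sum {ι : Type*} {r : ℕ} (s : Finset ι) (φ : ι → Op C r) (a : Fin r → Tot C) :
    homDiff (∑ i ∈ s, φ i) a = ∑ i ∈ s, homDiff (φ i) a := by
  classical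
  induction s using Finset.induction_on with
  | empty => simp [homDiff]
  | insert i s hi ih => rw [Finset.sum_insert hi, Finset.sum_insert hi, homDiff_add, ih]

/-- The composition `e ∘ (σ, τ)` of permutations of two letters. -/
def blockPerm (x : Equiv.Perm (Fin 2) × Equiv.Perm (Fin 2)) : Equiv.Perm (Fin 4) :=
  perm4 (permComp (s := fun _ => 2) 1 ![x.1, x.2])

theorem homDiff_act_H₁ {n : ℕ} (x : E 2 n) (a : Fin 4 → Tot C) :
    homDiff (A.act 4 (n + 1) (H₁ x)) a =
      prismSum (fun σ => swap23 * f σ) g (faceSum (evalList A a)) (List.ofFn x) := by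
  rw [H₁, map_sum, homDiff_sum, prismSum_ofFn]
  exact Finset.sum_congr rfl fun i _ => homDiff_act_cls A a _

theorem homDiff_act_H₂ {n : ℕ} (x : E 2 n) (a : Fin 4 → Tot C) :
    homDiff (A.act 4 (n + 1) (H₂ x)) a =
      shihSum (faceSum fun l => evalList A a (l.map blockPerm)) (List.ofFn x) := by
  simp only [H₂, map_sum, homDiff_sum, shihSum_ofFn]
  refine Finset.sum_congr rfl fun p _ => Finset.sum_congr rfl fun q _ =>
    Finset.sum_congr rfl fun VW _ => ?_
  rw [homDiff_act_cls, ← faceSum_map, List.map_ofFn]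
  rfl

theorem blockPerm_self (σ : Equiv.Perm (Fin 2)) : blockPerm (σ, σ) = g σ := by
  revert σ; decide

theorem blockPerm_swap_mul (σ τ : Equiv.Perm (Fin 2)) :
    blockPerm (Equiv.swap 0 1 * σ, Equiv.swap 0 1 * τ) =
      g (Equiv.swap 0 1) * blockPerm (σ, τ) := by
  revert σ τ; decide

/-- Conjugation by `(23)` takes `f(12) = (13)(24)` to `g(12) = (12)(34)`. The twist thus makes both
ends of the prism equivariant for the same permutation. -/
theorem swap23_mul_f_swap_mul (σ : Equiv.Perm (Fin 2)) :
    swap23 * f (Equiv.swap 0 1 * σ) = g (Equiv.swap 0 1) * (swap23 * f σ) := by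
  revert σ; decide

theorem g_swap_mul (σ : Equiv.Perm (Fin 2)) :
    g (Equiv.swap 0 1 * σ) = g (Equiv.swap 0 1) * g σ := by
  revert σ; decide

theorem act_cls_mul {r n : ℕ} (σ : Equiv.Perm (Fin r)) (x : E r n) (a : Fin r → Tot C)
    (h : ∀ j, a (σ j) = a j) :
    A.act r n (cls fun t => σ * x t) a = A.act r n (cls x) a := by
  rw [A.act_perm]
  exact congrArg _ (funext h)

theorem evalList_map_mul {r : ℕ} (σ : Equiv.Perm (Fin r)) (a : Fin r → Tot C)
    (h : ∀ j, a (σ j) = a j) (l : List (Equiv.Perm (Fin r))) :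
    evalList A a (l.map (σ * ·)) = evalList A a l := by
  rcases eq_or_ne l [] with rfl | hl
  · rfl
  obtain ⟨n, hn⟩ : ∃ n, l.length = n + 1 := ⟨l.length - 1, by
    have := List.length_pos_iff.2 hl; omega⟩
  obtain ⟨x, rfl⟩ : ∃ x : E r n, l = List.ofFn x := ⟨fun t => l[t]'(by omega), by
    refine List.ext_getElem (by simp [hn]) fun t h h' => by rw [List.getElem_ofFn]; rfl⟩
  rw [List.map_ofFn, ← act_cls_eq_evalList, ← act_cls_eq_evalList]
  exact act_cls_mul A σ x a h

end Evaluation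

/-! ### Operadic composition and iterated cup products -/

section Composition

open CategoryTheory

variable {C : ChainComplex (ModuleCat.{u} (ZMod 2)) ℤ} (A : Algebra C)

theorem Shuffle.ne_none {r : ℕ} {m : Fin r → ℕ} (c : Shuffle 0 m) (u : Fin (0 + ∑ j, m j)) :
    c.1 u ≠ none := by
  intro hu
  have h := c.2 none
  rw [degs, Option.elim, Finset.card_eq_zero, Finset.filter_eq_empty_iff] at h
  exact h (Finset.mem_univ u) hu

/-- Shuffles for a vertex and two simplices are the sets of steps allotted to the second one. -/
theorem sum_shuffle {M : Type*} [AddCommMonoid M] (m : Fin 2 → ℕ) (G : Finset ℕ → M) :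
    ∑ c : Shuffle 0 m,
        G ((Finset.univ.filter fun u => c.1 u = some 1).map Fin.valEmbedding) =
      ∑ V ∈ Finset.powersetCard (m 1) (Finset.range (0 + ∑ j, m j)), G V := by
  have hnone := fun c : Shuffle 0 m => c.ne_none
  have hcases : ∀ o : Option (Fin 2), o = none ∨ o = some 0 ∨ o = some 1 := by decide
  refine Finset.sum_bij (fun c _ => (Finset.univ.filter fun u => c.1 u = some 1).map
    Fin.valEmbedding) ?_ ?_ ?_ fun _ _ => rfl
  · intro c _
    rw [Finset.mem_powersetCard, Finset.card_map]
    refine ⟨fun u hu => ?_, c.2 (some 1)⟩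
    obtain ⟨v, _, rfl⟩ := Finset.mem_map.1 hu
    exact Finset.mem_range.2 v.2
  · intro c _ c' _ h
    have h := Finset.map_injective _ h
    refine Subtype.ext (funext fun u => ?_)
    have hu : c.1 u = some 1 ↔ c'.1 u = some 1 := by
      simpa using Finset.ext_iff.1 h u
    rcases hcases (c.1 u) with h1 | h1 | h1 <;> rcases hcases (c'.1 u) with h2 | h2 | h2 <;>
      simp_all
  · intro V hV
    obtain ⟨hV, hc⟩ := Finset.mem_powersetCard.1 hV
    let c : Fin (0 + ∑ j, m j) → Option (Fin 2) := fun u => if u.1 ∈ V then some 1 else some 0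
    have hs : (Finset.univ.filter fun u => c u = some 1).map Fin.valEmbedding = V := by
      ext u
      simp only [Finset.mem_map, Finset.mem_filter, Finset.mem_univ, true_and, c,
        Fin.valEmbedding_apply]
      constructor
      · rintro ⟨v, hv, rfl⟩
        by_contra h
        simp [h] at hv
      · intro hu
        exact ⟨⟨u, Finset.mem_range.1 (hV hu)⟩, by simp [hu], rfl⟩
    have h1 : (Finset.univ.filter fun u => c u = some 1).card = m 1 :=
      (Finset.card_map _).symm.trans ((congrArg _ hs).trans hc)
    have h01 : (Finset.univ.filter fun u => c u = some 1).card +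
        (Finset.univ.filter fun u => ¬ c u = some 1).card = 0 + ∑ j, m j := by
      rw [Finset.card_filter_add_card_filter_not]; simp
    have e : ∀ u, (¬ c u = some 1) ↔ c u = some 0 := fun u => by
      by_cases h : u.1 ∈ V <;> simp [c, h]
    simp only [e, h1, Fin.sum_univ_two, zero_add] at h01
    refine ⟨⟨c, fun j => ?_⟩, Finset.mem_univ _, hs⟩
    rcases hcases j with rfl | rfl | rfl
    · rw [degs, Option.elim, Finset.card_eq_zero, Finset.filter_eq_empty_iff]
      intro u _
      by_cases h : u.1 ∈ V <;> simp [c, h]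
    · change (Finset.univ.filter fun u => c u = some 0).card = m 0
      omega
    · exact h1

theorem vertex_one {m : Fin 2 → ℕ} (c : Shuffle 0 m) (t : Fin (0 + ∑ j, m j + 1)) :
    (c.vertex (some 1) t).val = countBelow
      ((Finset.univ.filter fun u => c.1 u = some 1).map Fin.valEmbedding) t := by
  rw [countBelow, Finset.filter_map, Finset.card_map, Finset.filter_filter, Shuffle.vertex]
  simp [and_comm]

theorem vertex_zero {m : Fin 2 → ℕ} (c : Shuffle 0 m) (t : Fin (0 + ∑ j, m j + 1)) :
    (c.vertex (some 0) t).val = t - countBelow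
      ((Finset.univ.filter fun u => c.1 u = some 1).map Fin.valEmbedding) t := by
  have hcases : ∀ o : Option (Fin 2), o ≠ none → (o = some 0 ↔ ¬ o = some 1) := by decide
  have h : (Finset.univ.filter fun u : Fin (0 + ∑ j, m j) => u.val < t.val).card = t := by
    have := Fin.card_filter_val_lt (n := 0 + ∑ j, m j) (m := t.val)
    rw [this]
    exact min_eq_right t.is_le
  rw [← vertex_one, eq_comm, Nat.sub_eq_iff_eq_add, ← h, Shuffle.vertex, Shuffle.vertex]
  · simp only
    rw [← Finset.card_filter_add_card_filter_not (p := fun u => c.1 u = some 0),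
      Finset.filter_filter, Finset.filter_filter]
    congr 3
    ext u
    simp [hcases _ (c.ne_none u)]
  · rw [vertex_one]; exact countBelow_le _ _

theorem act_perm4 {n : ℕ} (z : E (∑ _ : Fin 2, 2) n) (h : ∑ _ : Fin 2, 2 = 4)
    (a : Fin 4 → Tot C) :
    A.act _ n (cls z) (fun k => a (finCongr h k)) = A.act 4 n (cls fun t => perm4 (z t)) a := by
  have key : ∀ (r r' : ℕ) (h : r = r') (z : E r n) (a : Fin r' → Tot C),
      A.act r n (cls z) (fun k => a (finCongr h k)) =
        A.act r' n (cls fun t => (finCongr h).permCongr (z t)) a := by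
    rintro r _ rfl z a
    rfl
  exact key _ _ h z a

theorem act_comp_two {n : ℕ} {m : Fin 2 → ℕ} (x : E 2 n) (y : (j : Fin 2) → E 2 (m j))
    (a : Fin 4 → Tot C) :
    A.act 2 n (cls x) ![A.act 2 (m 0) (cls (y 0)) ![a 0, a 1],
        A.act 2 (m 1) (cls (y 1)) ![a 2, a 3]] =
      ∑ c : Shuffle n m, A.act 4 (n + ∑ j, m j) (cls fun t =>
        perm4 (permComp (s := fun _ => 2) (x (c.vertex none t)) fun j =>
          y j (c.vertex (some j) t))) a := by
  have h := A.act_comp 2 n (fun _ => 2) m x y fun k => a (finCongr (by simp) k)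
  have e : (fun j : Fin 2 => A.act 2 (m j) (cls (y j)) fun k =>
      a (finCongr (by simp) (finSigmaFinEquiv (n := fun _ : Fin 2 => 2) ⟨j, k⟩))) =
      ![A.act 2 (m 0) (cls (y 0)) ![a 0, a 1], A.act 2 (m 1) (cls (y 1)) ![a 2, a 3]] := by
    funext j
    fin_cases j
    · refine congrArg _ (funext fun k => ?_)
      fin_cases k <;> rfl
    · refine congrArg _ (funext fun k => ?_)
      fin_cases k <;> rfl
  rw [← e, ← h, opComp, map_sum, sum_apply]
  exact Finset.sum_congr rfl fun c _ => act_perm4 A _ _ a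

theorem xTilde_zero : xTilde 0 = fun _ => 1 := by
  funext t
  have ht : (t : ℕ) = 0 := by omega
  rw [xTilde, ht, pow_zero]

/-- The outer factor is a point and receives no steps, so the three-factor shuffles reduce to
lattice paths in the product of the two inner simplices. -/
theorem cup_zero_act {m : Fin 2 → ℕ} (y : (j : Fin 2) → E 2 (m j)) (a : Fin 4 → Tot C) :
    cup A 0 (A.act 2 (m 0) (cls (y 0)) ![a 0, a 1]) (A.act 2 (m 1) (cls (y 1)) ![a 2, a 3]) =
      shuffleSum (fun l => evalList A a (l.map blockPerm)) (List.ofFn (y 0)) (List.ofFn (y 1)) := by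
  rw [cup, act_comp_two, xTilde_zero, ofFn_eq_range_map_entry, ofFn_eq_range_map_entry,
    shuffleSum_eq_sum _ _ _ _ _ (0 + ∑ j, m j) (by simp [Fin.sum_univ_two]), ← sum_shuffle]
  refine Finset.sum_congr rfl fun c _ => ?_
  rw [act_cls_eq_evalList, List.map_map]
  congr 1
  refine List.ext_getElem (by simp) fun t h _ => ?_
  simp only [List.length_ofFn] at h
  simp only [List.getElem_ofFn, List.getElem_map, List.getElem_range, Function.comp_apply,
    blockPerm]
  congr 2
  funext j
  have h0 := vertex_zero c ⟨t, h⟩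
  have h1 := vertex_one c ⟨t, h⟩
  have hl : ∀ j, (c.vertex (some j) ⟨t, h⟩).val ≤ m j := fun j =>
    Nat.lt_succ_iff.1 (c.vertex (some j) ⟨t, h⟩).2
  simp only at h0 h1
  fin_cases j
  · change y 0 _ = entry (y 0) _
    rw [entry]
    congr 1
    exact Fin.ext (by simp only; rw [← h0, min_eq_left (hl 0)]; rfl)
  · change y 1 _ = entry (y 1) _
    rw [entry]
    congr 1
    exact Fin.ext (by simp only; rw [← h1, min_eq_left (hl 1)]; rfl)

/-- Both inner factors are points, so a single shuffle exists: every step belongs to the outer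
simplex. -/
theorem cup_cup_zero (i : ℕ) (a : Fin 4 → Tot C) :
    cup A i (cup A 0 (a 0) (a 1)) (cup A 0 (a 2) (a 3)) =
      evalList A a ((List.ofFn (xTilde i)).map f) := by
  have h := act_comp_two A (m := fun _ => 0) (xTilde i) (fun _ => xTilde 0) a
  rw [cup, cup, cup, h]
  let c₀ : Shuffle (r := 2) i (fun _ => 0) := ⟨fun _ => none, fun j => by
    cases j <;> simp [degs]⟩
  have hc : ∀ c : Shuffle (r := 2) i (fun _ => 0), c = c₀ := by
    intro c
    refine Subtype.ext (funext fun u => ?_)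
    cases hu : c.1 u with
    | none => rfl
    | some j =>
      have h := c.2 (some j)
      rw [degs, Option.elim, Finset.card_eq_zero, Finset.filter_eq_empty_iff] at h
      exact absurd hu (h (Finset.mem_univ u))
  rw [Fintype.sum_eq_single c₀ fun c h => absurd (hc c) h, act_cls_eq_evalList, List.map_ofFn]
  congr 1
  refine List.ext_getElem (by simp) fun t h h' => ?_
  simp only [List.getElem_ofFn, Function.comp_apply, f]
  congr 2
  · congr 1
    refine Fin.ext ?_
    have ht : t < i + 1 := by simpa using h
    simp only [Shuffle.vertex, c₀, and_true]
    rw [Fin.card_filter_val_lt]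
    simp; omega
  · funext j
    exact congrFun xTilde_zero _

end Composition

/-! ### The Cartan relation -/

section CartanRelation

open CategoryTheory

variable {C : ChainComplex (ModuleCat.{u} (ZMod 2)) ℤ} (A : Algebra C)

theorem ofFn_swap_pow (j n : ℕ) :
    List.ofFn (fun t : Fin (n + 1) => (Equiv.swap 0 1 : Equiv.Perm (Fin 2)) ^ (j + t.val)) =
      orbitList (Equiv.swap 0 1 * ·) (Equiv.swap 0 1 ^ j) n := by
  induction n generalizing j with
  | zero => simp [orbitList]
  | succ n ih =>
    rw [List.ofFn_succ, orbitList, ← pow_succ', ← ih]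
    simp only [Fin.val_zero, add_zero, Fin.val_succ]
    congr 2
    funext t
    congr 1
    omega

theorem ofFn_xTilde (i : ℕ) :
    List.ofFn (xTilde i) = orbitList (Equiv.swap 0 1 * ·) 1 i := by
  rw [← pow_zero (Equiv.swap 0 1), ← ofFn_swap_pow]
  simp only [zero_add]
  rfl

theorem swap_mul_iterate (j : ℕ) :
    (fun σ : Equiv.Perm (Fin 2) => Equiv.swap 0 1 * σ)^[j] 1 = Equiv.swap 0 1 ^ j := by
  simp [mul_left_iterate]

/-- An operation of arity two evaluated at `α ⊗ α` is invariant. -/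
theorem act_swap_pow_mul (j k : ℕ) (α : Tot C) :
    A.act 2 k (cls fun t : Fin (k + 1) => (Equiv.swap 0 1 : Equiv.Perm (Fin 2)) ^ (j + t.val))
      ![α, α] = cup A k α α := by
  have h := act_cls_mul A ((Equiv.swap 0 1 : Equiv.Perm (Fin 2)) ^ j) (xTilde k) ![α, α]
    fun t => by
      have : ∀ s : Fin 2, (![α, α] : Fin 2 → Tot C) s = α := by
        intro s; fin_cases s <;> rfl
      rw [this, this]
  rw [cup, ← h]
  simp only [xTilde, pow_add]

/-- The front faces of `x̃ᵢ` are the `x̃ⱼ`, and the complementary back faces are `(12)ʲ x̃ₖ`; the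
factor `(12)ʲ` is absorbed by the symmetry of `β ⊗ β`. -/
theorem splitSum_shuffleSum_xTilde (i : ℕ) (α β : Tot C) :
    splitSum (shuffleSum fun l => evalList A ![α, α, β, β] (l.map blockPerm))
        (List.ofFn (xTilde i)) =
      ∑ jk ∈ Finset.HasAntidiagonal.antidiagonal i,
        cup A 0 (cup A jk.1 α α) (cup A jk.2 β β) := by
  rw [ofFn_xTilde, splitSum_orbitList]
  refine Finset.sum_congr rfl fun jk _ => ?_
  have h := cup_zero_act A (m := ![jk.1, jk.2])
    (fun j u => (Equiv.swap 0 1 : Equiv.Perm (Fin 2)) ^ (![0, jk.1] j + u.val)) ![α, α, β, β]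
  rw [← act_swap_pow_mul A 0 jk.1 α, ← act_swap_pow_mul A jk.1 jk.2 β, swap_mul_iterate,
    ← ofFn_swap_pow, ← pow_zero (Equiv.swap 0 1), ← ofFn_swap_pow]
  exact h.symm

theorem homDiff_cartanOp (i : ℕ) (α β : Tot C) :
    homDiff (cartanOp A i) ![α, α, β, β] = cartanRelation A i α β := by
  set a : Fin 4 → Tot C := ![α, α, β, β] with ha
  set ev := evalList A a with hev
  set l := List.ofFn (xTilde i) with hl
  -- `K` is the action of `H₁ + H₂` on `α ⊗ α ⊗ β ⊗ β`, as a function of the simplex of `E(2)`.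
  let K : List (Equiv.Perm (Fin 2)) → Tot C := fun l =>
    prismSum (fun σ => swap23 * f σ) g ev l + shihSum (fun l => ev (l.map blockPerm)) l
  have hl0 : l ≠ [] := by rw [hl, ofFn_xTilde]; cases i <;> simp [orbitList]
  have hinv : ∀ l, ev (l.map (g (Equiv.swap 0 1) * ·)) = ev l := by
    refine evalList_map_mul A _ _ fun j => ?_
    -- The arguments are replaced by the labels of their positions, which makes the symmetry
    -- decidable.
    have h : ∀ j, (![0, 0, 1, 1] : Fin 4 → Fin 2) (g (Equiv.swap 0 1) j) =
        (![0, 0, 1, 1] : Fin 4 → Fin 2) j := by decide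
    have h' : ∀ j, a j = ![α, β] ((![0, 0, 1, 1] : Fin 4 → Fin 2) j) := by
      intro j; fin_cases j <;> rfl
    rw [h', h', h]
  have hK : Normalized K := ((normalized_evalList A a).prismSum _ _).add
    ((normalized_evalList A a).comp_map blockPerm).shihSum
  have hKinv : ∀ l, K (l.map (Equiv.swap 0 1 * ·)) = K l := by
    intro l
    simp only [K]
    rw [prismSum_map _ _ _ _ (g (Equiv.swap 0 1) * ·) swap23_mul_f_swap_mul g_swap_mul,
      shihSum_map]
    have h : blockPerm ∘ Prod.map (Equiv.swap 0 1 * ·) (Equiv.swap 0 1 * ·) =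
        (g (Equiv.swap 0 1) * ·) ∘ blockPerm := funext fun x => blockPerm_swap_mul x.1 x.2
    simp only [List.map_map, h]
    simp only [← List.map_map, hinv]
  -- This is the vanishing of `H(∂x̃ᵢ)`: the two outer faces differ by `(12)`, under which `K` is
  -- invariant.
  have hface : faceSum K l = 0 := by
    rw [hl, ofFn_xTilde]
    rcases i with _ | i
    · simp [orbitList, faceSum, K, prismSum, shihSum]
    · have hT : ∀ σ : Equiv.Perm (Fin 2),
          Equiv.swap 0 1 * (Equiv.swap 0 1 * σ) = σ := fun σ => by
        rw [← mul_assoc, Equiv.swap_mul_self, one_mul]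
      rw [faceSum_orbitList hK _ hT, ← orbitList_map, hKinv, ZModModule.add_self]
  have hdiag : (l.map fun σ => (σ, σ)).map blockPerm = l.map g := by
    rw [List.map_map]
    exact List.map_congr_left fun σ _ => blockPerm_self σ
  -- The permutation `(23)` reorders `α ⊗ α ⊗ β ⊗ β` into `α ⊗ β ⊗ α ⊗ β`.
  have hcup : ev (l.map fun σ => swap23 * f σ) = cup A i (cup A 0 α β) (cup A 0 α β) := by
    have h := cup_cup_zero A i ![α, β, α, β]
    rw [List.map_ofFn, ← act_cls_eq_evalList] at h
    rw [hl, List.map_ofFn, hev, ← act_cls_eq_evalList]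
    refine (A.act_perm _ _ swap23 (f ∘ xTilde i) a).trans (Eq.trans ?_ h.symm)
    congr 1
    funext j
    fin_cases j <;> rfl
  have hp := prismSum_faceSum (fun σ => swap23 * f σ) g ev l
  have hs := shihSum_faceSum (fun l => ev (l.map blockPerm)) l hl0
  rw [faceSum_add] at hface
  rw [hdiag, hl, splitSum_shuffleSum_xTilde, ← hl] at hs
  rw [cartanOp, map_add, homDiff_add, homDiff_act_H₁, homDiff_act_H₂, cartanRelation, ← hcup]
  change prismSum _ g (faceSum ev) l + shihSum (faceSum fun l => ev (l.map blockPerm)) l = _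
  have h2 := ZModModule.add_self (ev (l.map g))
  calc _ = (prismSum (fun σ => swap23 * f σ) g (faceSum ev) l
          + faceSum (prismSum (fun σ => swap23 * f σ) g ev) l)
        + (shihSum (faceSum fun l => ev (l.map blockPerm)) l
          + faceSum (shihSum fun l => ev (l.map blockPerm)) l)
        - (faceSum (prismSum (fun σ => swap23 * f σ) g ev) l
          + faceSum (shihSum fun l => ev (l.map blockPerm)) l) := by abel
    _ = ev (l.map fun σ => swap23 * f σ) + ∑ jk ∈ Finset.HasAntidiagonal.antidiagonal i,
          cup A 0 (cup A jk.1 α α) (cup A jk.2 β β) + (ev (l.map g) + ev (l.map g)) := by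
      rw [hp, hs, hface]; abel
    _ = _ := by rw [h2, add_zero]

theorem isCartanCoboundary_zeta (i : ℕ) : IsCartanCoboundary A i (zeta A i) := by
  intro α β hα hβ
  rw [← homDiff_cartanOp, homDiff, zeta, left_eq_add]
  -- On cycles every summand of `Z ∘ ∂` has a zero argument.
  refine Finset.sum_eq_zero fun j _ => (cartanOp A i).map_coord_zero j ?_
  rw [Function.update_self]
  fin_cases j <;> assumption

theorem zeta_mem_deg (i : ℕ) (p q : ℤ) (α β : Tot C) (hα : α ∈ deg C p) (hβ : β ∈ deg C q) :
    zeta A i α β ∈ deg C (2 * p + 2 * q + i + 1) := by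
  have h := A.act_deg 4 (i + 1) (H₁ (xTilde i) + H₂ (xTilde i)) ![α, α, β, β] ![p, p, q, q]
    fun j => by fin_cases j <;> assumption
  have e : ((i + 1 : ℕ) : ℤ) + ∑ j, ![p, p, q, q] j = 2 * p + 2 * q + i + 1 := by
    simp [Fin.sum_univ_four]
    ring
  rwa [e] at h

theorem mapTot_zeta {D : ChainComplex (ModuleCat.{u} (ZMod 2)) ℤ} {B : Algebra D} {φ : C ⟶ D}
    (h : IsAlgebraHom A B φ) (i : ℕ) (α β : Tot C) :
    mapTot φ (zeta A i α β) = zeta B i (mapTot φ α) (mapTot φ β) := by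
  rw [zeta, cartanOp, h]
  refine congrArg _ (funext fun j => ?_)
  fin_cases j <;> rfl

end CartanRelation

end BarrattEccles

theorem theorem3 (C : ChainComplex (ModuleCat.{u} (ZMod 2)) ℤ) (A : BarrattEccles.Algebra C)
    (i : ℕ) :
    -- for all elements, with the boundary taken in `Hom(C ⊗ C ⊗ C ⊗ C, C)`
    (∀ α β : BarrattEccles.Tot C,
      BarrattEccles.homDiff (BarrattEccles.cartanOp A i) ![α, α, β, β] =
        BarrattEccles.cartanRelation A i α β) ∧
    -- for cycles
    BarrattEccles.IsCartanCoboundary A i (BarrattEccles.zeta A i) ∧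
    -- degrees
    (∀ (p q : ℤ) (α β : BarrattEccles.Tot C),
      α ∈ BarrattEccles.deg C p → β ∈ BarrattEccles.deg C q →
        BarrattEccles.zeta A i α β ∈ BarrattEccles.deg C (2 * p + 2 * q + i + 1)) ∧
    -- naturality
    (∀ (D : ChainComplex (ModuleCat.{u} (ZMod 2)) ℤ) (B : BarrattEccles.Algebra D) (φ : C ⟶ D),
      BarrattEccles.IsAlgebraHom A B φ → ∀ α β : BarrattEccles.Tot C,
        BarrattEccles.mapTot φ (BarrattEccles.zeta A i α β) =
          BarrattEccles.zeta B i (BarrattEccles.mapTot φ α) (BarrattEccles.mapTot φ β)) := by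
  exact ⟨BarrattEccles.homDiff_cartanOp A i, BarrattEccles.isCartanCoboundary_zeta A i,
    BarrattEccles.zeta_mem_deg A i, fun _ _ _ h => BarrattEccles.mapTot_zeta A h i⟩
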